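/- Let $d \in \mathbb{N}$, let $Y$ be a real Banach space, $K \subseteq Y$ a closed convex cone with $K \cap (-K) = \{0\}$, and write $y_1 \preceq_K y_2$ iff $y_2 - y_1 \in K$. Let $g_0, h_0 \colon \mathbb{R}^d \to \mathbb{R}$ be convex, let $G, H \colon \mathbb{R}^d \to Y$ be $K$-convex, i.e. $\Phi(\alpha x_1 + (1-\alpha) x_2) \preceq_K \alpha \Phi(x_1) + (1-\alpha)\Phi(x_2)$ for all $x_1, x_2 \in \mathbb{R}^d$, $\alpha \in [0,1]$ and $\Phi \in \{G, H\}$, and let $A \subseteq \mathbb{R}^d$ be closed and convex. Put $f_0 = g_0 - h_0$, $F = G - H$, and consider the problem $$(\mathcal{P}) \qquad \text{minimize } f_0(x) \quad \text{subject to} \quad F(x) \preceq_K 0, \quad x \in A.$$ For $z \in A$ at which $H$ is Fréchet differentiable with derivative $DH(z)$ let $F_z(x) = G(x) - H(z) - DH(z)(x - z)$ and $\Omega(z) = \{x \in A \mid F_z(x) \preceq_K 0\}$. For a convex function $h$ let $\partial h(x) = \{ v \mid h(z) \ge h(x) + \langle v, z - x\rangle \ \forall z \in \mathbb{R}^d\}$,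 and let $N_V(x) = \{ v \mid \langle v, z - x\rangle \le 0 \ \forall z \in V\}$. A point $x_*$ is called critical for $(\mathcal{P})$ if $\partial h_0(x_*) \cap (\partial g_0(x_*) + N_{\Omega(x_*)}(x_*)) \ne \emptyset$. The penalty convex-concave procedure with infeasibility tolerance $\varkappa = 0$ and $\tau_{\max} = +\infty$ is the following. Choose $x_0 \in A$, $\mu > 1$ and a continuous linear functional $t_0 \in Y^*$ with $\langle t_0, y \rangle > 0$ for all $y \in K \setminus \{0\}$. For every $n \ge 0$ choose $v_n \in \partial h_0(x_n)$, let $(x_{n+1}, s_{n+1})$ be any globally optimal solution of $$\min_{(x, s)} \ g_0(x) - \langle v_n, x - x_n \rangle + \langle t_n, s \rangle \quad \text{subject to} \quad F_{x_n}(x) \preceq_K s, \quad s \succeq_K 0, \quad x \in A,$$ and put $t_{n+1} = \mu t_n$ if $\| s_{n+1} \| > 0$, and $t_{n+1} = t_n$ otherwise. (We consider infinite runs; iterations with $x_{n+1} = x_n$ are allowed, so runs in which the stopping test $x_{n+1} = x_n$ is never met are a special case.) **Theorem.** Let $K$ be finite dimensional (i.e. its linear span is), let $G$ be continuous on $A$,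 let $H$ be continuously Fréchet differentiable on $A$ (i.e. $H$ is Fréchet differentiable at every point of $A$ and $x \mapsto DH(x)$ is continuous on $A$), and suppose that there exists $c \ge 0$ such that the penalty function $\Phi_c(\cdot) = f_0(\cdot) + c \, \mathrm{dist}(F(\cdot), -K)$ is coercive on $A$, i.e. $\Phi_c(u_n) \to +\infty$ for every sequence $\{u_n\} \subset A$ with $\|u_n\| \to +\infty$. Suppose that an infinite sequence $\{x_n\}$ generated by the procedure above converges to a point $x_*$ such that $$0 \in \operatorname{int} \{ G(x) - H(x_*) - DH(x_*)(x - x_*) + y \mid x \in A, \ y \in K \}.$$ Then the sequence $\{t_n\}$ is bounded, there exists $m \in \mathbb{N}$ such that $x_n$ is feasible for $(\mathcal{P})$ for all $n \ge m$, and the point $x_*$ is feasible and critical for $(\mathcal{P})$. -/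

import Mathlib

open Set Filter Topology
open scoped Pointwise ENNReal InnerProductSpace

noncomputable section

/-- `Φ` is convex with respect to the cone `K` on the whole space. -/
def IsConeConvex {E Y : Type*} [AddCommGroup E] [Module ℝ E]
    [NormedAddCommGroup Y] [NormedSpace ℝ Y] (K : ProperCone ℝ Y) (Φ : E → Y) : Prop :=
  ∀ x₁ x₂ : E, ∀ α ∈ Icc (0 : ℝ) 1,
    α • Φ x₁ + (1 - α) • Φ x₂ - Φ (α • x₁ + (1 - α) • x₂) ∈ K

/-- The subdifferential of a real-valued convex function on `ℝᵈ`. -/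
def subdiff {d : ℕ} (h : EuclideanSpace ℝ (Fin d) → ℝ) (x : EuclideanSpace ℝ (Fin d)) :
    Set (EuclideanSpace ℝ (Fin d)) :=
  {v | ∀ z, h x + ⟪v, z - x⟫_ℝ ≤ h z}

/-- The normal cone to `V` at `x`. -/
def normalConeAt {d : ℕ} (V : Set (EuclideanSpace ℝ (Fin d))) (x : EuclideanSpace ℝ (Fin d)) :
    Set (EuclideanSpace ℝ (Fin d)) :=
  {v | ∀ z ∈ V, ⟪v, z - x⟫_ℝ ≤ 0}

/-- `φ` is coercive on `A`. -/
def IsCoerciveOn {E : Type*} [NormedAddCommGroup E] (φ : E → ℝ) (A : Set E) : Prop :=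
  ∀ u : ℕ → E, (∀ n, u n ∈ A) → Tendsto (fun n => ‖u n‖) atTop atTop →
    Tendsto (fun n => φ (u n)) atTop atTop

/-- The functional `t` is strictly positive on the cone: `t` is in the dual cone and
`⟨t, y⟩ > 0` for all nonzero `y` in `K`. -/
def IsStrictlyPositiveOn {Y : Type*} [NormedAddCommGroup Y] [NormedSpace ℝ Y]
    (K : ProperCone ℝ Y) (t : Y →L[ℝ] ℝ) : Prop :=
  (∀ y ∈ K, 0 ≤ t y) ∧ ∀ y ∈ K, y ≠ 0 → 0 < t y

/-- The data of the cone constrained DC problem: minimize `g₀ - h₀` subject to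
`G x - H x ∈ -K`, `x ∈ A`. A `ProperCone` of Mathlib is a nonempty closed convex cone; that
it contains no line is the field `salient`. -/
structure ConeDCProblem (d : ℕ) (Y : Type*) [NormedAddCommGroup Y] [NormedSpace ℝ Y] where
  g₀ : EuclideanSpace ℝ (Fin d) → ℝ
  h₀ : EuclideanSpace ℝ (Fin d) → ℝ
  G : EuclideanSpace ℝ (Fin d) → Y
  H : EuclideanSpace ℝ (Fin d) → Y
  K : ProperCone ℝ Y
  A : Set (EuclideanSpace ℝ (Fin d))
  convex_g₀ : ConvexOn ℝ univ g₀
  convex_h₀ : ConvexOn ℝ univ h₀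
  salient : ∀ y ∈ K, -y ∈ K → y = 0
  convex_G : IsConeConvex K G
  convex_H : IsConeConvex K H
  closed_A : IsClosed A
  convex_A : Convex ℝ A

namespace ConeDCProblem

variable {d : ℕ} {Y : Type*} [NormedAddCommGroup Y] [NormedSpace ℝ Y] (P : ConeDCProblem d Y)

/-- The objective function. -/
def f₀ (x : EuclideanSpace ℝ (Fin d)) : ℝ := P.g₀ x - P.h₀ x

/-- The constraint mapping. -/
def F (x : EuclideanSpace ℝ (Fin d)) : Y := P.G x - P.H x

/-- The feasible region of the problem. -/
def feasibleSet : Set (EuclideanSpace ℝ (Fin d)) := {x | x ∈ P.A ∧ -P.F x ∈ P.K}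

/-- The penalty function `f₀ + c dist(F, -K)`. -/
def penalty (c : ℝ) (x : EuclideanSpace ℝ (Fin d)) : ℝ :=
  P.f₀ x + c * Metric.infDist (P.F x) (-(P.K : Set Y))

/-- The constraint mapping with `H` linearized at `z`. -/
def linF (z x : EuclideanSpace ℝ (Fin d)) : Y := P.G x - P.H z - fderiv ℝ P.H z (x - z)

/-- The feasible region `Ω(z)` of the convex problem linearized at `z`. -/
def linFeasibleSet (z : EuclideanSpace ℝ (Fin d)) : Set (EuclideanSpace ℝ (Fin d)) :=
  {x | x ∈ P.A ∧ -P.linF z x ∈ P.K}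

/-- Slater's condition for the convex problem linearized at `z`. -/
def SlaterAt (z : EuclideanSpace ℝ (Fin d)) : Prop :=
  (0 : Y) ∈ interior {y | ∃ x ∈ P.A, ∃ k ∈ P.K, y = P.linF z x + k}

/-- Critical points of the problem. -/
def IsCritical (z : EuclideanSpace ℝ (Fin d)) : Prop :=
  (subdiff P.h₀ z ∩ (subdiff P.g₀ z + normalConeAt (P.linFeasibleSet z) z)).Nonempty

/-- The feasible region of the penalized convex subproblem at `z`, in the variables `(x, s)`. -/
def subproblemSet (z : EuclideanSpace ℝ (Fin d)) : Set (EuclideanSpace ℝ (Fin d) × Y) :=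
  {p | p.2 - P.linF z p.1 ∈ P.K ∧ p.2 ∈ P.K ∧ p.1 ∈ P.A}

/-- The objective function of the penalized convex subproblem. -/
def subproblemObj (z v : EuclideanSpace ℝ (Fin d)) (t : Y →L[ℝ] ℝ)
    (p : EuclideanSpace ℝ (Fin d) × Y) : ℝ :=
  P.g₀ p.1 - ⟪v, p.1 - z⟫_ℝ + t p.2

/-- An infinite run of the penalty convex-concave procedure with growth factor `μ`,
infeasibility tolerance `ϰ` and bound `τmax` on the norm of the penalty parameter. The penalty
parameter is increased iff the infeasibility measure `‖s (n + 1)‖` exceeds the tolerance and the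
bound allows it. The value `s 0` plays no role. Iterations with `x (n + 1) = x n` are allowed, so
that runs in which the stopping test is never met are a special case. -/
structure IsPenaltyCCPRun (μ ϰ : ℝ) (τmax : ℝ≥0∞) (x : ℕ → EuclideanSpace ℝ (Fin d))
    (s : ℕ → Y) (v : ℕ → EuclideanSpace ℝ (Fin d)) (t : ℕ → Y →L[ℝ] ℝ) : Prop where
  init_mem : x 0 ∈ P.A
  init_pos : IsStrictlyPositiveOn P.K (t 0)
  one_lt : 1 < μ
  subgrad : ∀ n, v n ∈ subdiff P.h₀ (x n)
  step_mem : ∀ n, (x (n + 1), s (n + 1)) ∈ P.subproblemSet (x n)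
  step_min : ∀ n, IsMinOn (P.subproblemObj (x n) (v n) (t n)) (P.subproblemSet (x n))
    (x (n + 1), s (n + 1))
  update : ∀ n, ϰ < ‖s (n + 1)‖ ∧ ENNReal.ofReal (μ * ‖t n‖) ≤ τmax → t (n + 1) = μ • t n
  no_update : ∀ n, ¬ (ϰ < ‖s (n + 1)‖ ∧ ENNReal.ofReal (μ * ‖t n‖) ≤ τmax) → t (n + 1) = t n

end ConeDCProblem

end

/-! The penalty is exact because Slater's condition at the limit is stable. Modulo the span of `K`
the linearized constraint is affine, so its upper image lies in a finite dimensional subspace; an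
interior point then forces `Y` itself to be finite dimensional. Hence a ball about 0 sits inside the
hull of finitely many upper values, and small perturbations of these still enclose the ball of half
the radius: for large `n` the linearizations at `x n` share a radius `r` and a compact set `C` of
Slater points (`exists_uniform_slater`).

A point that violates a linearized constraint by `e` is repaired by moving it a fraction `‖e‖ / (r +
‖e‖)` towards a point of `C` (`IsConeConvex.exists_repair`). Comparing a subproblem optimum with its
repair bounds `t n (s (n + 1))` by a constant times `‖s (n + 1)‖`, whereas after `k` updates it is
at least `μ ^ k * δ * ‖s (n + 1)‖`. So only finitely many slacks are nonzero: `t` is eventually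
constant, and the iterates lie in linearized feasible regions, which the gradient inequality for `H`
places inside the feasible set.

Repair also shows that every point of the linearized region at the limit is a limit of points of the
regions at `x n`. Optimality thus survives the limit along convergent subgradients, and Hahn-Banach
separation turns it into criticality. -/

/-! ### Cone convex maps and stability of Slater's condition -/

section ConeConvex

variable {E Y : Type*} [NormedAddCommGroup E] [NormedSpace ℝ E]
  [NormedAddCommGroup Y] [NormedSpace ℝ Y] {K : ProperCone ℝ Y}

/-- Subtracting an affine map preserves cone convexity. -/
theorem IsConeConvex.sub_affine {Φ : E → Y} (hΦ : IsConeConvex K Φ) (c : Y) (D : E →L[ℝ] Y)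
    (z : E) : IsConeConvex K (fun x => Φ x - c - D (x - z)) := by
  intro x₁ x₂ α hα
  convert hΦ x₁ x₂ α hα using 1
  simp only [map_sub, map_add, map_smul]
  module

/-- The gradient inequality for cone convex maps. -/
theorem IsConeConvex.gradient_ineq {Φ : E → Y} (hΦ : IsConeConvex K Φ) {z : E}
    (hd : DifferentiableAt ℝ Φ z) (x : E) : Φ x - Φ z - fderiv ℝ Φ z (x - z) ∈ K := by
  -- Divide the convexity inequality on the segment from `z` to `x` by `α` and let `α` decrease to
  -- 0.
  have hlim := (hd.hasFDerivAt.hasLineDerivAt (x - z)).tendsto_slope_zero_right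
  have hlim' := hlim.const_sub (Φ x - Φ z)
  refine K.isClosed.mem_of_tendsto hlim' ?_
  filter_upwards [Ioo_mem_nhdsGT (zero_lt_one' ℝ)] with α hα
  have h := K.smul_mem (hΦ x z α ⟨hα.1.le, hα.2.le⟩) (inv_nonneg.2 hα.1.le)
  have e : α • x + (1 - α) • z = z + α • (x - z) := by module
  rw [e] at h
  rw [SetLike.mem_coe]
  convert h using 1
  have hα' : α ≠ 0 := hα.1.ne'
  simp only [smul_sub, smul_add, smul_smul, sub_smul, inv_mul_cancel₀ hα', one_smul]
  abel

/-- The set of upper bounds of values of a cone convex map on a convex set is convex. -/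
theorem IsConeConvex.convex_upperImage {L : E → Y} (hL : IsConeConvex K L) {C : Set E}
    (hC : Convex ℝ C) : Convex ℝ {y | ∃ x ∈ C, y - L x ∈ K} := by
  rintro y₁ ⟨x₁, hx₁, h₁⟩ y₂ ⟨x₂, hx₂, h₂⟩ a b ha hb hab
  refine ⟨a • x₁ + b • x₂, hC hx₁ hx₂ ha hb hab, ?_⟩
  have h := hL x₁ x₂ a ⟨ha, by linarith⟩
  have e : 1 - a = b := by linarith
  rw [e] at h
  convert add_mem (add_mem (K.smul_mem h₁ ha) (K.smul_mem h₂ hb)) h using 1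
  module

/-- A point at which the constraint is violated by at most `e` can be moved towards a compactly
located Slater point so that the constraint is satisfied. -/
theorem IsConeConvex.exists_repair {L : E → Y} (hL : IsConeConvex K L) {C : Set E} {r : ℝ}
    (hr : 0 < r) (hC : ∀ y ∈ Metric.closedBall (0 : Y) r, ∃ x ∈ C, y - L x ∈ K)
    {x : E} {e : Y} (he : e - L x ∈ K) :
    ∃ c ∈ C, -L ((‖e‖ / (r + ‖e‖)) • c + (1 - ‖e‖ / (r + ‖e‖)) • x) ∈ K := by
  -- Aim at the point of norm `r` opposite to `e`; the weight is the one for which the convex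
  -- combination of this target and `e` vanishes.
  obtain ⟨c, hc, hcK⟩ := hC (-(r / ‖e‖) • e) (by
    rw [mem_closedBall_zero_iff, norm_smul, norm_neg, Real.norm_of_nonneg (by positivity)]
    rcases eq_or_ne e 0 with rfl | hne
    · simpa using hr.le
    · rw [div_mul_cancel₀ _ (norm_ne_zero_iff.2 hne)])
  refine ⟨c, hc, ?_⟩
  have hre : 0 < r + ‖e‖ := by positivity
  have h0 : 0 ≤ ‖e‖ / (r + ‖e‖) := by positivity
  have h1 : ‖e‖ / (r + ‖e‖) ≤ 1 := (div_le_one hre).2 (by linarith)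
  have h := hL c x _ ⟨h0, h1⟩
  have hsum := add_mem (add_mem (K.smul_mem hcK h0)
    (K.smul_mem he (sub_nonneg.2 h1))) h
  convert hsum using 1
  have key : (‖e‖ / (r + ‖e‖)) • (-(r / ‖e‖) • e) + (1 - ‖e‖ / (r + ‖e‖)) • e = 0 := by
    rcases eq_or_ne e 0 with rfl | hne
    · simp
    · have hn : ‖e‖ ≠ 0 := norm_ne_zero_iff.2 hne
      rw [smul_smul, ← add_smul]
      convert zero_smul ℝ e using 2
      field_simp
      ring
  rw [smul_sub, smul_sub]
  calc _ = (0 : Y) - L ((‖e‖ / (r + ‖e‖)) • c + (1 - ‖e‖ / (r + ‖e‖)) • x) := by simp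
    _ = _ := by rw [← key]; abel_nf

/-- Modulo the span of the cone, a cone convex map is affine. Hence, if its upper image has
an interior point, the whole space is finite dimensional as soon as the cone is. -/
theorem IsConeConvex.finiteDimensional [FiniteDimensional ℝ E] {L : E → Y}
    (hL : IsConeConvex K L) (hK : FiniteDimensional ℝ (Submodule.span ℝ (K : Set Y)))
    {S : Set E} (hint : (interior {y | ∃ x ∈ S, ∃ k ∈ K, y = L x + k}).Nonempty) :
    FiniteDimensional ℝ Y := by
  set N := Submodule.span ℝ (K : Set Y) with hN
  have hKN : ∀ k ∈ K, N.mkQ k = 0 := fun k hk => by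
    simpa using Submodule.subset_span hk
  have haff : ∀ x y : E, ∀ α ∈ Icc (0 : ℝ) 1,
      N.mkQ (L (α • x + (1 - α) • y)) = α • N.mkQ (L x) + (1 - α) • N.mkQ (L y) := by
    intro x y α hα
    have h := hKN _ (hL x y α hα)
    rw [map_sub, map_add, map_smul, map_smul, sub_eq_zero] at h
    exact h.symm
  -- The affine map modulo `N`, normalized at 0. Homogeneity on `[0, 1]` and midpoints give
  -- additivity; inverses and negation give all scalars.
  let ψ : E → Y ⧸ N := fun x => N.mkQ (L x) - N.mkQ (L 0)
  have hscale : ∀ α ∈ Icc (0 : ℝ) 1, ∀ x, ψ (α • x) = α • ψ x := by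
    intro α hα x
    have h := haff x 0 α hα
    simp only [smul_zero, add_zero] at h
    simp only [ψ, h]
    module
  have hadd : ∀ x y, ψ (x + y) = ψ x + ψ y := by
    intro x y
    have h := haff x y (1 / 2) ⟨by norm_num, by norm_num⟩
    have h2 := hscale (1 / 2) ⟨by norm_num, by norm_num⟩ (x + y)
    have e : (1 / 2 : ℝ) • x + (1 - 1 / 2 : ℝ) • y = (1 / 2 : ℝ) • (x + y) := by module
    rw [e] at h
    have h3 : (1 / 2 : ℝ) • ψ (x + y) = (1 / 2 : ℝ) • (ψ x + ψ y) := by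
      rw [← h2]
      simp only [ψ, h]
      module
    exact smul_right_injective _ (by norm_num : (1 / 2 : ℝ) ≠ 0) h3
  have hpos : ∀ α : ℝ, 0 ≤ α → ∀ x, ψ (α • x) = α • ψ x := by
    intro α hα x
    rcases le_total α 1 with h1 | h1
    · exact hscale α ⟨hα, h1⟩ x
    · have hα' : α ≠ 0 := by positivity
      have h := hscale α⁻¹ ⟨by positivity, inv_le_one_of_one_le₀ h1⟩ (α • x)
      rw [inv_smul_smul₀ hα'] at h
      rw [h, smul_inv_smul₀ hα']
  have hneg : ∀ x, ψ (-x) = -ψ x := by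
    intro x
    have h := hadd x (-x)
    rw [add_neg_cancel] at h
    have h0 : ψ 0 = 0 := sub_self _
    rw [h0] at h
    exact (neg_eq_of_add_eq_zero_right h.symm).symm
  let ψl : E →ₗ[ℝ] Y ⧸ N :=
    { toFun := ψ
      map_add' := hadd
      map_smul' := by
        intro α x
        rcases le_total 0 α with h | h
        · exact hpos α h x
        · have h' := hpos (-α) (by linarith) (-x)
          rw [smul_neg, neg_smul, neg_neg, hneg] at h'
          simpa using h' }
  -- `M` is finite dimensional, and its preimage contains the upper image, hence is everything.
  let M : Submodule ℝ (Y ⧸ N) := LinearMap.range ψl ⊔ Submodule.span ℝ {N.mkQ (L 0)}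
  have hM : M.comap N.mkQ = ⊤ := by
    refine Submodule.eq_top_of_nonempty_interior' _ (hint.mono (interior_mono ?_))
    rintro y ⟨x, -, k, hk, rfl⟩
    have e : N.mkQ (L x + k) = ψl x + N.mkQ (L 0) := by
      rw [map_add, hKN k hk, add_zero]
      exact (sub_add_cancel _ _).symm
    change N.mkQ (L x + k) ∈ M
    rw [e]
    exact add_mem (Submodule.mem_sup_left ⟨x, rfl⟩)
      (Submodule.mem_sup_right (Submodule.mem_span_singleton_self _))
  have hMtop : M = ⊤ := by
    rw [eq_top_iff]
    intro q _
    obtain ⟨y, rfl⟩ := N.mkQ_surjective q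
    have : y ∈ M.comap N.mkQ := hM ▸ Submodule.mem_top
    exact this
  have hfin : FiniteDimensional ℝ M := inferInstance
  have : FiniteDimensional ℝ (Y ⧸ N) := by
    rw [hMtop] at hfin
    exact Module.Finite.equiv Submodule.topEquiv
  exact Module.Finite.of_submodule_quotient N

/-- If the convex hull of finitely many points contains a ball around the origin, then so does
the convex hull of small perturbations of the points. -/
theorem closedBall_subset_convexHull_of_perturbation {ι : Type*} [Finite ι] {y y' : ι → Y}
    {r ε : ℝ} (hr : 0 < r) (hy : Metric.closedBall 0 r ⊆ convexHull ℝ (range y))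
    (hyy : ∀ i, ‖y i - y' i‖ ≤ ε) :
    Metric.closedBall 0 (r - ε) ⊆ convexHull ℝ (range y') := by
  intro z hz
  by_contra hcon
  -- A separating `f` is at most `u + ε * ‖f‖` on the old hull, so `r * ‖f‖ ≤ u + ε * ‖f‖`,
  -- contradicting `u < f z ≤ (r - ε) * ‖f‖`.
  obtain ⟨f, u, hfu, huz⟩ := geometric_hahn_banach_closed_point (convex_convexHull ℝ (range y'))
    ((finite_range y').isClosed_convexHull ℝ) hcon
  have hhull : convexHull ℝ (range y) ⊆ {w | f w ≤ u + ε * ‖f‖} := by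
    refine convexHull_min ?_ (convex_halfSpace_le f.isLinear _)
    rintro _ ⟨i, rfl⟩
    have h1 := hfu _ (subset_convexHull ℝ _ (mem_range_self i))
    have h2 : f (y i - y' i) ≤ ‖f‖ * ε :=
      (le_abs_self _).trans ((f.le_opNorm _).trans (by gcongr; exact hyy i))
    rw [map_sub] at h2
    simp only [mem_ofPred_eq]
    linarith
  have hnorm : ‖f‖ ≤ (u + ε * ‖f‖) / r := by
    refine f.opNorm_bound_of_ball_bound hr _ fun w hw => ?_
    rw [Real.norm_eq_abs, abs_le]
    have h1 := hhull (hy hw)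
    have h2 := hhull (hy (a := -w) (by simpa using hw))
    simp only [mem_ofPred_eq, map_neg] at h1 h2
    exact ⟨by linarith, h1⟩
  rw [le_div_iff₀ hr] at hnorm
  have hfz : f z ≤ ‖f‖ * (r - ε) :=
    (le_abs_self _).trans ((f.le_opNorm _).trans (by
      gcongr; exact mem_closedBall_zero_iff.1 hz))
  nlinarith

/-- Slater's condition is stable under pointwise convergence of cone convex maps, with Slater
points in a fixed compact set. -/
theorem exists_uniform_slater [FiniteDimensional ℝ Y] {A : Set E} (hA : Convex ℝ A)
    {L : E → Y} {Ln : ℕ → E → Y} (hLn : ∀ n, IsConeConvex K (Ln n))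
    (hlim : ∀ a ∈ A, Tendsto (fun n => Ln n a) atTop (𝓝 (L a)))
    (hint : (0 : Y) ∈ interior {y | ∃ x ∈ A, ∃ k ∈ K, y = L x + k}) :
    ∃ C ⊆ A, IsCompact C ∧ ∃ r > 0, ∀ᶠ n in atTop,
      ∀ y ∈ Metric.closedBall (0 : Y) r, ∃ x ∈ C, y - Ln n x ∈ K := by
  obtain ⟨b, hb0, hbS⟩ := exists_mem_interior_convexHull_affineBasis
    (mem_interior_iff_mem_nhds.1 hint)
  have hb : ∀ i, ∃ x ∈ A, ∃ k ∈ K, b i = L x + k := fun i =>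
    hbS (subset_convexHull ℝ _ (mem_range_self i))
  choose a haA k hkK hbe using hb
  obtain ⟨r, hr, hball⟩ := Metric.nhds_basis_closedBall.mem_iff.1
    (mem_interior_iff_mem_nhds.1 hb0)
  refine ⟨convexHull ℝ (range a), convexHull_min (range_subset_iff.2 haA) hA,
    (finite_range a).isCompact_convexHull ℝ, r / 2, half_pos hr, ?_⟩
  have hev : ∀ᶠ n in atTop, ∀ i, ‖b i - (Ln n (a i) + k i)‖ ≤ r / 2 := by
    rw [eventually_all]
    intro i
    have h1 : Tendsto (fun n => ‖b i - (Ln n (a i) + k i)‖) atTop (𝓝 0) := by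
      have h2 := (tendsto_const_nhds (x := b i)).sub ((hlim (a i) (haA i)).add_const (k i))
      rw [← hbe i, sub_self] at h2
      simpa using h2.norm
    exact h1.eventually_le_const (half_pos hr)
  filter_upwards [hev] with n hn y hy
  have hsub := closedBall_subset_convexHull_of_perturbation hr hball hn
  rw [sub_half] at hsub
  refine convexHull_min ?_ ((hLn n).convex_upperImage (convex_convexHull ℝ (range a))) (hsub hy)
  rintro _ ⟨i, rfl⟩
  exact ⟨a i, subset_convexHull ℝ _ (mem_range_self i), by simpa using hkK i⟩

/-- A strictly positive functional on a finite dimensional closed cone is bounded below by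
a multiple of the norm. -/
theorem IsStrictlyPositiveOn.exists_norm_le [FiniteDimensional ℝ Y] {t : Y →L[ℝ] ℝ}
    (ht : IsStrictlyPositiveOn K t) : ∃ δ > 0, ∀ y ∈ K, δ * ‖y‖ ≤ t y := by
  have hcomp : IsCompact ((K : Set Y) ∩ Metric.sphere 0 1) :=
    (isCompact_sphere 0 1).inter_left K.isClosed
  obtain ⟨δ, hδ, hmin⟩ : ∃ δ > 0, ∀ y ∈ (K : Set Y) ∩ Metric.sphere 0 1, δ ≤ t y := by
    rcases ((K : Set Y) ∩ Metric.sphere 0 1).eq_empty_or_nonempty with h | h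
    · exact ⟨1, one_pos, by simp [h]⟩
    · obtain ⟨y₀, hy₀, hm⟩ := hcomp.exists_isMinOn h t.continuous.continuousOn
      refine ⟨t y₀, ht.2 y₀ hy₀.1 ?_, fun y hy => hm hy⟩
      rintro rfl
      simpa using hy₀.2
  refine ⟨δ, hδ, fun y hy => ?_⟩
  rcases eq_or_ne y 0 with rfl | hne
  · simp
  have hn : 0 < ‖y‖ := norm_pos_iff.2 hne
  have h := hmin (‖y‖⁻¹ • y) ⟨K.smul_mem hy (by positivity), by simp [norm_smul, hn.ne']⟩
  rw [map_smul, smul_eq_mul, inv_mul_eq_div, le_div_iff₀ hn] at h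
  exact h

end ConeConvex

/-! ### Subgradients and the optimality condition -/

section Subdifferential

variable {d : ℕ}

theorem continuous_of_convexOn_univ {h : EuclideanSpace ℝ (Fin d) → ℝ}
    (hh : ConvexOn ℝ univ h) : Continuous h :=
  hh.locallyLipschitz.continuous

/-- Subgradients at the points of a bounded set are bounded. -/
theorem exists_norm_subgradient_le {h : EuclideanSpace ℝ (Fin d) → ℝ} (hc : Continuous h)
    {x v : ℕ → EuclideanSpace ℝ (Fin d)} (hx : Bornology.IsBounded (range x))
    (hv : ∀ n, v n ∈ subdiff h (x n)) : ∃ R, ∀ n, ‖v n‖ ≤ R := by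
  obtain ⟨ρ, hρ⟩ := hx.exists_norm_le
  obtain ⟨B, hB⟩ := (isCompact_closedBall (0 : EuclideanSpace ℝ (Fin d))
    (ρ + 1)).exists_bound_of_continuousOn hc.continuousOn
  refine ⟨2 * B, fun n => ?_⟩
  have hxn : ‖x n‖ ≤ ρ := hρ _ (mem_range_self n)
  rcases eq_or_ne (v n) 0 with h0 | h0
  · have := (norm_nonneg _).trans (hB (x n) (by simpa using by linarith))
    rw [h0, norm_zero]
    linarith
  have hn : ‖v n‖ ≠ 0 := norm_ne_zero_iff.2 h0
  -- A unit step along `v n` raises `h` by at least `‖v n‖`.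
  have h1 := hv n (x n + ‖v n‖⁻¹ • v n)
  rw [add_sub_cancel_left, inner_smul_right, real_inner_self_eq_norm_sq, pow_two,
    inv_mul_cancel_left₀ hn] at h1
  have h2 := hB (x n) (by simpa using by linarith)
  have h3 := hB (x n + ‖v n‖⁻¹ • v n) (by
    rw [mem_closedBall_zero_iff]
    refine (norm_add_le _ _).trans ?_
    rw [norm_smul, norm_inv, norm_norm, inv_mul_cancel₀ hn]
    linarith)
  rw [Real.norm_eq_abs, abs_le] at h2 h3
  linarith

/-- The graph of the subdifferential is closed. -/
theorem mem_subdiff_of_tendsto {ι : Type*} {l : Filter ι} [l.NeBot]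
    {h : EuclideanSpace ℝ (Fin d) → ℝ} (hc : Continuous h)
    {x v : ι → EuclideanSpace ℝ (Fin d)} {x₀ v₀ : EuclideanSpace ℝ (Fin d)}
    (hx : Tendsto x l (𝓝 x₀)) (hv : Tendsto v l (𝓝 v₀))
    (hmem : ∀ n, v n ∈ subdiff h (x n)) : v₀ ∈ subdiff h x₀ := fun z =>
  le_of_tendsto (((hc.tendsto x₀).comp hx).add (hv.inner (hx.const_sub z)))
    (Eventually.of_forall fun n => hmem n z)

/-- Optimality condition: if `x₀` minimizes `g - ⟨v, ·⟩` over a convex set, then `v` is the sum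
of a subgradient of `g` and a normal vector. -/
theorem mem_subdiff_add_normalConeAt {g : EuclideanSpace ℝ (Fin d) → ℝ} (hg : ConvexOn ℝ univ g)
    {V : Set (EuclideanSpace ℝ (Fin d))} (hV : Convex ℝ V) {x₀ v : EuclideanSpace ℝ (Fin d)}
    (hx₀ : x₀ ∈ V) (hmin : ∀ x ∈ V, g x₀ + ⟪v, x - x₀⟫_ℝ ≤ g x) :
    v ∈ subdiff g x₀ + normalConeAt V x₀ := by
  have hgc := continuous_of_convexOn_univ hg
  -- Separate the strict epigraph of `g - ⟨v, ·⟩` from the part of `V × ℝ` at or below the minimum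
  -- value.
  let S : Set (EuclideanSpace ℝ (Fin d) × ℝ) := {p | g p.1 - ⟪v, p.1⟫_ℝ < p.2}
  have hφ : ConvexOn ℝ univ fun x => g x - ⟪v, x⟫_ℝ := by
    refine ⟨convex_univ, fun x _ y _ a b ha hb hab => ?_⟩
    have h := hg.2 (mem_univ x) (mem_univ y) ha hb hab
    simp only [inner_add_right, inner_smul_right, smul_eq_mul] at h ⊢
    linarith
  have hSc : Convex ℝ S := by
    have h := hφ.convex_strict_epigraph
    simpa [S] using h
  have hSo : IsOpen S := isOpen_lt (by fun_prop) continuous_snd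
  let T : Set (EuclideanSpace ℝ (Fin d) × ℝ) := V ×ˢ Iic (g x₀ - ⟪v, x₀⟫_ℝ)
  have hTc : Convex ℝ T := hV.prod (convex_Iic _)
  have hdisj : Disjoint S T := by
    rw [Set.disjoint_left]
    rintro ⟨x, τ⟩ h1 ⟨h2, h3⟩
    have h4 := hmin x h2
    simp only [S, mem_ofPred_eq, mem_Iic, inner_sub_right] at h1 h3 h4
    linarith
  obtain ⟨f, u, hfS, hfT⟩ := geometric_hahn_banach_open hSc hSo hTc hdisj
  set β : ℝ := f (0, 1) with hβdef
  set w := (InnerProductSpace.toDual ℝ (EuclideanSpace ℝ (Fin d))).symm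
    (f.comp (ContinuousLinearMap.inl ℝ _ ℝ)) with hw
  have hf : ∀ x τ, f (x, τ) = ⟪w, x⟫_ℝ + τ * β := by
    intro x τ
    rw [hw, InnerProductSpace.toDual_symm_apply, hβdef, ← smul_eq_mul, ← map_smul]
    simp [← map_add]
  set m := g x₀ - ⟪v, x₀⟫_ℝ with hm
  -- The hyperplane is not vertical: compare two heights over `x₀`.
  have hβ : β < 0 := by
    have h1 := hfS (x₀, m + 1) (by simp [S, hm])
    have h2 := hfT (x₀, m) ⟨hx₀, mem_Iic.2 le_rfl⟩
    rw [hf] at h1 h2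
    linarith
  have hle : ∀ x, ⟪w, x⟫_ℝ + (g x - ⟪v, x⟫_ℝ) * β ≤ u := by
    intro x
    have hlim : Tendsto (fun τ : ℝ => ⟪w, x⟫_ℝ + τ * β) (𝓝[>] (g x - ⟪v, x⟫_ℝ))
        (𝓝 (⟪w, x⟫_ℝ + (g x - ⟪v, x⟫_ℝ) * β)) :=
      (Continuous.tendsto (by fun_prop) _).mono_left nhdsWithin_le_nhds
    refine le_of_tendsto hlim ?_
    filter_upwards [self_mem_nhdsWithin] with τ hτ
    rw [← hf]
    exact (hfS (x, τ) hτ).le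
  have hge : ∀ x ∈ V, u ≤ ⟪w, x⟫_ℝ + m * β := fun x hx => by
    rw [← hf]
    exact hfT _ ⟨hx, mem_Iic.2 le_rfl⟩
  have hx₀u : u = ⟪w, x₀⟫_ℝ + m * β := le_antisymm (hge x₀ hx₀) (hle x₀)
  refine ⟨v + (-β)⁻¹ • w, fun z => ?_, -((-β)⁻¹ • w), fun z hz => ?_, by abel⟩
  · have h := hle z
    have hpos : 0 < -β := by linarith
    have h' : ⟪w, z - x₀⟫_ℝ ≤ (-β) * ((g z - ⟪v, z⟫_ℝ) - m) := by
      rw [inner_sub_right]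
      linarith
    rw [← inv_mul_le_iff₀ hpos] at h'
    rw [inner_add_left, inner_smul_left, inner_sub_right v]
    simp only [conj_trivial]
    linarith
  · have h := hge z hz
    have hpos : 0 ≤ (-β)⁻¹ := by
      rw [inv_nonneg]
      linarith
    have h' : 0 ≤ ⟪w, z - x₀⟫_ℝ := by
      rw [inner_sub_right]
      linarith
    rw [inner_neg_left, inner_smul_left]
    simp only [conj_trivial]
    linarith [mul_nonneg hpos h']

end Subdifferential

/-! ### Linearized problems and runs of the procedure -/

namespace ConeDCProblem

variable {d : ℕ} {Y : Type*} [NormedAddCommGroup Y] [NormedSpace ℝ Y] {P : ConeDCProblem d Y}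

theorem isConeConvex_linF (z : EuclideanSpace ℝ (Fin d)) : IsConeConvex P.K (P.linF z) :=
  P.convex_G.sub_affine _ _ _

theorem linF_self (z : EuclideanSpace ℝ (Fin d)) : P.linF z z = P.F z := by
  simp [linF, F]

theorem convex_linFeasibleSet (z : EuclideanSpace ℝ (Fin d)) :
    Convex ℝ (P.linFeasibleSet z) := by
  rintro x ⟨hxA, hx⟩ y ⟨hyA, hy⟩ a b ha hb hab
  refine ⟨P.convex_A hxA hyA ha hb hab, ?_⟩
  have h := isConeConvex_linF (P := P) z x y a ⟨ha, by linarith⟩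
  rw [show 1 - a = b by linarith] at h
  convert add_mem (add_mem (P.K.smul_mem hx ha) (P.K.smul_mem hy hb)) h using 1
  module

/-- The linearized feasible regions are contained in the feasible region. -/
theorem linFeasibleSet_subset {z : EuclideanSpace ℝ (Fin d)} (hd : DifferentiableAt ℝ P.H z) :
    P.linFeasibleSet z ⊆ P.feasibleSet := by
  rintro x ⟨hxA, hx⟩
  refine ⟨hxA, ?_⟩
  convert add_mem hx (P.convex_H.gradient_ineq hd x) using 1
  simp only [linF, F]
  abel_nf

theorem mem_feasibleSet_of_tendsto (hG : ContinuousOn P.G P.A)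
    (hH : ∀ x ∈ P.A, DifferentiableAt ℝ P.H x) {x : ℕ → EuclideanSpace ℝ (Fin d)}
    {x₀ : EuclideanSpace ℝ (Fin d)} (hx : Tendsto x atTop (𝓝 x₀))
    (hmem : ∀ᶠ n in atTop, x n ∈ P.feasibleSet) : x₀ ∈ P.feasibleSet := by
  have hA : x₀ ∈ P.A := P.closed_A.mem_of_tendsto hx (hmem.mono fun n h => h.1)
  refine ⟨hA, ?_⟩
  have hxA : Tendsto x atTop (𝓝[P.A] x₀) :=
    tendsto_nhdsWithin_iff.2 ⟨hx, hmem.mono fun n h => h.1⟩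
  have h1 : Tendsto (fun n => -P.F (x n)) atTop (𝓝 (-P.F x₀)) :=
    (((hG x₀ hA).tendsto.comp hxA).sub ((hH x₀ hA).continuousAt.tendsto.comp hx)).neg
  exact P.K.isClosed.mem_of_tendsto h1 (hmem.mono fun n h => h.2)

theorem tendsto_linF (hH : ∀ x ∈ P.A, DifferentiableAt ℝ P.H x)
    (hH' : ContinuousOn (fderiv ℝ P.H) P.A) {z : ℕ → EuclideanSpace ℝ (Fin d)}
    {z₀ : EuclideanSpace ℝ (Fin d)} (hz : Tendsto z atTop (𝓝 z₀)) (hzA : ∀ n, z n ∈ P.A)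
    (x : EuclideanSpace ℝ (Fin d)) :
    Tendsto (fun n => P.linF (z n) x) atTop (𝓝 (P.linF z₀ x)) := by
  have hA : z₀ ∈ P.A := P.closed_A.mem_of_tendsto hz (Eventually.of_forall hzA)
  have hzA' : Tendsto z atTop (𝓝[P.A] z₀) :=
    tendsto_nhdsWithin_iff.2 ⟨hz, Eventually.of_forall hzA⟩
  have h1 := (hH z₀ hA).continuousAt.tendsto.comp hz
  have h2 : Tendsto (fun n => fderiv ℝ P.H (z n)) atTop (𝓝 (fderiv ℝ P.H z₀)) :=
    (hH' z₀ hA).tendsto.comp hzA'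
  have h3 := (isBoundedBilinearMap_apply.continuous.tendsto _).comp
    (h2.prodMk_nhds (hz.const_sub x))
  exact (h1.const_sub (P.G x)).sub h3

namespace IsPenaltyCCPRun

variable {μ : ℝ} {x : ℕ → EuclideanSpace ℝ (Fin d)} {s : ℕ → Y}
  {v : ℕ → EuclideanSpace ℝ (Fin d)} {t : ℕ → Y →L[ℝ] ℝ}

theorem mem_A (hrun : P.IsPenaltyCCPRun μ 0 ⊤ x s v t) : ∀ n, x n ∈ P.A
  | 0 => hrun.init_mem
  | n + 1 => (hrun.step_mem n).2.2

theorem penalty_eq_of_eq_zero (hrun : P.IsPenaltyCCPRun μ 0 ⊤ x s v t) {n : ℕ}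
    (h : s (n + 1) = 0) : t (n + 1) = t n :=
  hrun.no_update n (by simp [h])

open Classical in
/-- The penalty functional is the initial one times `μ` to the number of updates. -/
theorem penalty_eq (hrun : P.IsPenaltyCCPRun μ 0 ⊤ x s v t) (n : ℕ) :
    t n = μ ^ (Nat.count (fun i => s (i + 1) ≠ 0) n) • t 0 := by
  induction n with
  | zero => simp
  | succ n ih =>
    rw [Nat.count_succ]
    by_cases h : s (n + 1) = 0
    · rw [hrun.penalty_eq_of_eq_zero h, ih]
      simp [h]
    · rw [hrun.update n ⟨norm_pos_iff.2 h, le_top⟩, ih]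
      simp [h, pow_succ', mul_smul]

/-- When the slack vanishes, the next iterate solves the linearized problem without penalty. -/
theorem linearized_optimal (hrun : P.IsPenaltyCCPRun μ 0 ⊤ x s v t) {n : ℕ}
    (hs : s (n + 1) = 0) : x (n + 1) ∈ P.linFeasibleSet (x n) ∧
      ∀ z ∈ P.linFeasibleSet (x n), P.g₀ (x (n + 1)) + ⟪v n, z - x (n + 1)⟫_ℝ ≤ P.g₀ z := by
  have hmem := hrun.step_mem n
  rw [hs] at hmem
  refine ⟨⟨hmem.2.2, by simpa using hmem.1⟩, fun z hz => ?_⟩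
  have h := hrun.step_min n (a := (z, 0)) ⟨by simpa using hz.2, P.K.zero_mem, hz.1⟩
  simp only [mem_ofPred_eq, subproblemObj, hs, map_zero, inner_sub_right] at h ⊢
  linarith

/-- Exactness of the penalty: along a convergent run the slack is eventually zero. -/
theorem eventually_slack_eq_zero [FiniteDimensional ℝ Y]
    (hrun : P.IsPenaltyCCPRun μ 0 ⊤ x s v t) (hx : Bornology.IsBounded (range x))
    {C : Set (EuclideanSpace ℝ (Fin d))} (hCA : C ⊆ P.A) (hC : IsCompact C) {r : ℝ} (hr : 0 < r)
    (hslater : ∀ᶠ n in atTop, ∀ y ∈ Metric.closedBall (0 : Y) r,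
      ∃ c ∈ C, y - P.linF (x n) c ∈ P.K) :
    ∀ᶠ n in atTop, s (n + 1) = 0 := by
  classical
  obtain ⟨δ, hδ, hδt⟩ := hrun.init_pos.exists_norm_le
  obtain ⟨R, hR⟩ := exists_norm_subgradient_le (continuous_of_convexOn_univ P.convex_h₀) hx
    hrun.subgrad
  obtain ⟨ρ, hρ⟩ := hx.exists_norm_le
  obtain ⟨ρ', hρ'⟩ := hC.isBounded.exists_norm_le
  obtain ⟨B, hB⟩ := (isCompact_closedBall (0 : EuclideanSpace ℝ (Fin d))
    (max ρ ρ')).exists_bound_of_continuousOn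
      (continuous_of_convexOn_univ P.convex_g₀).continuousOn
  have hgap : ∀ n, ∀ c ∈ C,
      P.g₀ c - P.g₀ (x (n + 1)) - ⟪v n, c - x (n + 1)⟫_ℝ ≤ 2 * B + R * (ρ' + ρ) := by
    intro n c hc
    have hxn := hρ _ (mem_range_self (n + 1))
    have hcn := hρ' c hc
    have h1 := hB c (by simp [hcn])
    have h2 := hB (x (n + 1)) (by simp [hxn])
    have h3 : -⟪v n, c - x (n + 1)⟫_ℝ ≤ R * (ρ' + ρ) :=
      (neg_le_abs _).trans ((abs_real_inner_le_norm _ _).trans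
        (mul_le_mul (hR n) ((norm_sub_le _ _).trans (add_le_add hcn hxn)) (norm_nonneg _)
          ((norm_nonneg _).trans (hR n))))
    rw [Real.norm_eq_abs, abs_le] at h1 h2
    linarith
  set D := 2 * B + R * (ρ' + ρ)
  -- A nonzero slack is possible only while the penalty factor is below a fixed bound: compare with
  -- the repaired point and zero slack, then cancel `‖s (n + 1)‖`.
  have hbound : ∀ᶠ n in atTop, s (n + 1) ≠ 0 →
      μ ^ (Nat.count (fun i => s (i + 1) ≠ 0) n) ≤ D / (r * δ) := by
    filter_upwards [hslater] with n hn hs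
    obtain ⟨hsF, hsK, hxA⟩ := hrun.step_mem n
    obtain ⟨c, hc, hcK⟩ := (isConeConvex_linF (P := P) (x n)).exists_repair hr hn hsF
    have hspos : 0 < ‖s (n + 1)‖ := norm_pos_iff.2 hs
    set lam := ‖s (n + 1)‖ / (r + ‖s (n + 1)‖) with hlam
    have hden : 0 < r + ‖s (n + 1)‖ := by positivity
    have h0 : 0 < lam := by positivity
    have h1 : lam ≤ 1 := (div_le_one hden).2 (by linarith)
    have hmem : (lam • c + (1 - lam) • x (n + 1), (0 : Y)) ∈ P.subproblemSet (x n) :=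
      ⟨by simpa using hcK, P.K.zero_mem,
        P.convex_A (hCA hc) hxA h0.le (sub_nonneg.2 h1) (by ring)⟩
    have hopt := hrun.step_min n hmem
    have hconv := P.convex_g₀.2 (mem_univ c) (mem_univ (x (n + 1))) h0.le (sub_nonneg.2 h1)
      (by ring)
    have hg := hgap n c hc
    simp only [mem_ofPred_eq, subproblemObj, map_zero, inner_sub_right, inner_add_right,
      inner_smul_right, smul_eq_mul] at hopt hconv hg
    have ht : t n (s (n + 1)) ≤ lam * D := by
      have := mul_le_mul_of_nonneg_left hg h0.le
      linarith
    have hD : 0 ≤ μ ^ (Nat.count (fun i => s (i + 1) ≠ 0) n) :=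
      pow_nonneg (by linarith [hrun.one_lt]) _
    rw [hrun.penalty_eq n, smul_apply, smul_eq_mul] at ht
    have hlow := mul_le_mul_of_nonneg_left (hδt _ hsK) hD
    set q := μ ^ (Nat.count (fun i => s (i + 1) ≠ 0) n)
    have hD' : 0 ≤ D := by
      have : 0 ≤ lam * D := (mul_nonneg hD (hrun.init_pos.1 _ hsK)).trans ht
      exact nonneg_of_mul_nonneg_right this h0
    have hle : lam * D ≤ ‖s (n + 1)‖ / r * D := by
      rw [hlam]
      gcongr
      linarith
    rw [le_div_iff₀ (by positivity)]
    have hfin : q * (δ * ‖s (n + 1)‖) ≤ ‖s (n + 1)‖ / r * D := (hlow.trans ht).trans hle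
    rw [div_mul_eq_mul_div, le_div_iff₀ hr] at hfin
    exact le_of_mul_le_mul_left (by linarith) hspos
  by_contra hcon
  have hinf : {i | s (i + 1) ≠ 0}.Infinite := by
    rw [← Nat.frequently_atTop_iff_infinite]
    exact not_eventually.1 hcon
  obtain ⟨n₀, hn₀⟩ := eventually_atTop.1 hbound
  obtain ⟨k, hk⟩ := pow_unbounded_of_one_lt (D / (r * δ)) hrun.one_lt
  -- The nonzero slack of index `m` is preceded by exactly `m` updates and occurs at a step `≥ m ≥
  -- n₀`.
  set m := max n₀ k
  have h1 := hn₀ (Nat.nth (fun i => s (i + 1) ≠ 0) m)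
    ((le_max_left _ _).trans (Nat.nth_strictMono hinf).le_apply) (Nat.nth_mem_of_infinite hinf m)
  rw [Nat.count_nth_of_infinite hinf] at h1
  have h2 : μ ^ k ≤ μ ^ m := pow_le_pow_right₀ hrun.one_lt.le (le_max_right _ _)
  linarith

/-- Limits of runs with vanishing slack are critical. -/
theorem isCritical_of_tendsto (hrun : P.IsPenaltyCCPRun μ 0 ⊤ x s v t)
    {x₀ : EuclideanSpace ℝ (Fin d)} (hx : Tendsto x atTop (𝓝 x₀)) (hx₀ : x₀ ∈ P.feasibleSet)
    {C : Set (EuclideanSpace ℝ (Fin d))} (hCA : C ⊆ P.A) (hC : IsCompact C) {r : ℝ} (hr : 0 < r)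
    (hslater : ∀ᶠ n in atTop, ∀ y ∈ Metric.closedBall (0 : Y) r,
      ∃ c ∈ C, y - P.linF (x n) c ∈ P.K)
    (hlin : ∀ z, Tendsto (fun n => P.linF (x n) z) atTop (𝓝 (P.linF x₀ z)))
    (hslack : ∀ᶠ n in atTop, s (n + 1) = 0) : P.IsCritical x₀ := by
  have hgc := continuous_of_convexOn_univ P.convex_g₀
  have hhc := continuous_of_convexOn_univ P.convex_h₀
  obtain ⟨R, hR⟩ := exists_norm_subgradient_le hhc (Metric.isBounded_range_of_tendsto x hx)
    hrun.subgrad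
  obtain ⟨v₀, -, φ, hφ, hv⟩ := (isCompact_closedBall (0 : EuclideanSpace ℝ (Fin d))
    R).tendsto_subseq (x := v) fun n => by simpa using hR n
  have hφt := hφ.tendsto_atTop
  refine ⟨v₀, mem_subdiff_of_tendsto hhc (hx.comp hφt) hv fun n => hrun.subgrad _, ?_⟩
  refine mem_subdiff_add_normalConeAt P.convex_g₀ (convex_linFeasibleSet x₀)
    ⟨hx₀.1, by rw [linF_self]; exact hx₀.2⟩ fun z hz => ?_
  -- As `z` satisfies the limit constraint, it violates the one at `x n` by at most `e n`, which
  -- tends to 0.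
  let e : ℕ → Y := fun n => P.linF (x n) z - P.linF x₀ z
  have he : Tendsto (fun n => ‖e n‖) atTop (𝓝 0) := by
    have := (hlin z).sub_const (P.linF x₀ z)
    rw [sub_self] at this
    simpa using this.norm
  let lam : ℕ → ℝ := fun n => ‖e n‖ / (r + ‖e n‖)
  have hlam : Tendsto lam atTop (𝓝 0) := by
    have h := he.div (he.const_add r) (by simpa using hr.ne')
    rw [zero_div] at h
    exact h
  have hex : ∀ᶠ n in atTop, ∃ c ∈ C, -P.linF (x n) (lam n • c + (1 - lam n) • z) ∈ P.K := by
    filter_upwards [hslater] with n hn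
    refine (isConeConvex_linF (P := P) (x n)).exists_repair hr hn ?_
    simpa [e] using hz.2
  obtain ⟨n₀, hn₀⟩ := eventually_atTop.1 hex
  choose! c hcC hcK using hn₀
  have hzlim : Tendsto (fun n => lam n • c n + (1 - lam n) • z) atTop (𝓝 z) := by
    have h1 : Tendsto (fun n => lam n • c n) atTop (𝓝 0) := by
      obtain ⟨ρ, hρ⟩ := hC.isBounded.exists_norm_le
      refine hlam.zero_smul_isBoundedUnder_le ?_
      refine isBoundedUnder_of_eventually_le (a := ρ) ?_
      filter_upwards [eventually_ge_atTop n₀] with n hn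
      exact hρ _ (hcC n hn)
    have h2 := h1.add ((hlam.const_sub 1).smul_const z)
    simpa using h2
  have hmain : ∀ᶠ n in atTop, P.g₀ (x (n + 1)) +
      ⟪v n, (lam n • c n + (1 - lam n) • z) - x (n + 1)⟫_ℝ ≤
        P.g₀ (lam n • c n + (1 - lam n) • z) := by
    filter_upwards [hslack, eventually_ge_atTop n₀] with n hs hn
    have hpos : 0 < r + ‖e n‖ := by positivity
    have h0 : 0 ≤ lam n := by positivity
    have h1 : lam n ≤ 1 := (div_le_one hpos).2 (by linarith)
    exact (hrun.linearized_optimal hs).2 _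
      ⟨P.convex_A (hCA (hcC n hn)) hz.1 h0 (sub_nonneg.2 h1) (by ring), hcK n hn⟩
  have hx1 : Tendsto (fun n => x (n + 1)) atTop (𝓝 x₀) := hx.comp (tendsto_add_atTop_nat 1)
  refine le_of_tendsto_of_tendsto
    ((((hgc.tendsto x₀).comp hx1).comp hφt).add (hv.inner ((hzlim.sub hx1).comp hφt)))
    (((hgc.tendsto z).comp hzlim).comp hφt) ?_
  exact hφt.eventually hmain

end IsPenaltyCCPRun

end ConeDCProblem

/-! ### The convergence theorem -/

theorem mainTheorem12 {d : ℕ} {Y : Type*} [NormedAddCommGroup Y] [NormedSpace ℝ Y]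
    [CompleteSpace Y] (P : ConeDCProblem d Y)
    (hK : FiniteDimensional ℝ (Submodule.span ℝ (P.K : Set Y)))
    (hG : ContinuousOn P.G P.A)
    (hH : ∀ x ∈ P.A, DifferentiableAt ℝ P.H x)
    (hH' : ContinuousOn (fderiv ℝ P.H) P.A)
    (hcoer : ∃ c : ℝ, 0 ≤ c ∧ IsCoerciveOn (P.penalty c) P.A)
    (μ : ℝ) (x : ℕ → EuclideanSpace ℝ (Fin d)) (s : ℕ → Y)
    (v : ℕ → EuclideanSpace ℝ (Fin d)) (t : ℕ → Y →L[ℝ] ℝ)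
    (hrun : P.IsPenaltyCCPRun μ 0 ⊤ x s v t)
    (xstar : EuclideanSpace ℝ (Fin d))
    (hlim : Tendsto x atTop (𝓝 xstar))
    (hslater : P.SlaterAt xstar) :
    (∃ M : ℝ, ∀ n, ‖t n‖ ≤ M) ∧
    (∃ m : ℕ, ∀ n ≥ m, x n ∈ P.feasibleSet) ∧
    xstar ∈ P.feasibleSet ∧ P.IsCritical xstar := by
  have hfin : FiniteDimensional ℝ Y :=
    (ConeDCProblem.isConeConvex_linF (P := P) xstar).finiteDimensional hK ⟨0, hslater⟩
  have hlin := ConeDCProblem.tendsto_linF hH hH' hlim hrun.mem_A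
  obtain ⟨C, hCA, hC, r, hr, hunif⟩ := exists_uniform_slater P.convex_A
    (fun n => ConeDCProblem.isConeConvex_linF (P := P) (x n)) (fun a _ => hlin a) hslater
  have hslack := hrun.eventually_slack_eq_zero (Metric.isBounded_range_of_tendsto x hlim)
    hCA hC hr hunif
  obtain ⟨m, hm⟩ := eventually_atTop.1 hslack
  -- The shift by one is needed since `s (k + 1) = 0` concerns the iterate `x (k + 1)`.
  have hfeas : ∀ n ≥ m + 1, x n ∈ P.feasibleSet := by
    intro n hn
    obtain ⟨k, rfl⟩ : ∃ k, n = k + 1 := ⟨n - 1, by omega⟩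
    exact ConeDCProblem.linFeasibleSet_subset (hH _ (hrun.mem_A k))
      (hrun.linearized_optimal (hm k (by omega))).1
  have hstar := ConeDCProblem.mem_feasibleSet_of_tendsto hG hH hlim
    (eventually_atTop.2 ⟨m + 1, hfeas⟩)
  refine ⟨?_, ⟨m + 1, hfeas⟩, hstar,
    hrun.isCritical_of_tendsto hlim hstar hCA hC hr hunif hlin hslack⟩
  have hconst : ∀ n ≥ m, t n = t m := by
    intro n hn
    induction n, hn using Nat.le_induction with
    | base => rfl
    | succ k hk ih => rw [hrun.penalty_eq_of_eq_zero (hm k hk), ih]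
  have ht : Tendsto t atTop (𝓝 (t m)) :=
    tendsto_const_nhds.congr' (eventually_atTop.2 ⟨m, fun n hn => (hconst n hn).symm⟩)
  obtain ⟨M, hM⟩ := (Metric.isBounded_range_of_tendsto t ht).exists_norm_le
  exact ⟨M, fun n => hM _ (mem_range_self n)⟩
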